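/- Let $T\in\mathbb N$, let $\Omega_1$ be a Polish space and $\Omega_i:=\Omega_1^i$ for $0\le i\le T$ ($\Omega_0$ a singleton). For a Polish space $X$ let $\mathfrak P(X)$ be the set of Borel probability measures on $X$ with the weak topology. For each $i\in\{0,\dots,T-1\}$ and $\omega\in\Omega_i$ let $\mathcal P_i(\omega)\subset\mathfrak P(\Omega_1)$ be a nonempty convex set, such that $\operatorname{graph}(\mathcal P_i)=\{(\omega,P):\omega\in\Omega_i,\ P\in\mathcal P_i(\omega)\}$ is an analytic subset of $\Omega_i\times\mathfrak P(\Omega_1)$. Let $S_i:\Omega_i\to\mathbb R$ be Borel measurable, $i=0,\dots,T$. For $i\in\{0,\dots,T-1\}$ and $\omega\in\Omega_i$ put $$\mathcal Q_i(\omega):=\{Q\in\mathfrak P(\Omega_1):\ Q\ll P\text{ for some }P\in\mathcal P_i(\omega),\ E_Q[S_{i+1}(\omega,\cdot)-S_i(\omega)]=0\},$$ where the expectation being $0$ includes that the increment is $Q$-integrable. For $t\in\{0,\dots,T-1\}$, $\omega\in\Omega_t$ and universally measurable kernels $K_i:\Omega_i\to\mathfrak P(\Omega_1)$, $i=t,\dots,T-1$,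 let $K_t\otimes\dots\otimes K_{T-1}$ denote the probability measure on $\Omega_{T-t}$ (depending on $\omega$) $$A\mapsto\int_{\Omega_1}\cdots\int_{\Omega_1}1_A(x_1,\dots,x_{T-t})\,K_{T-1}(\omega,x_1,\dots,x_{T-t-1};dx_{T-t})\cdots K_t(\omega;dx_1).$$ Define $\mathbb P_t(\omega)\subset\mathfrak P(\Omega_{T-t})$ as the set of all $P_t\otimes\dots\otimes P_{T-1}$, where each $P_i$ is a universally measurable kernel with $P_i(\eta)\in\mathcal P_i(\eta)$ for all $\eta\in\Omega_i$. Define the set $\mathcal M_t(\omega)\subset\mathfrak P(\Omega_{T-t})$ of dominated martingale measures from time $t$ as the set of all $R=Q_t\otimes\dots\otimes Q_{T-1}$, where each $Q_i$ is a universally measurable kernel with $Q_i(\eta)\in\mathcal Q_i(\eta)$ for all $\eta\in\Omega_i$ with $\mathcal Q_i(\eta)\ne\emptyset$, and where, for $i=t,\dots,T-1$, $\mathcal Q_i(\omega,x_1,\dots,x_{i-t})\neq\emptyset$ for $R$-almost every $(x_1,\dots,x_{T-t})$. Let $t\in\{0,\dots,T-1\}$. If the graph $\{(\omega,P):\omega\in\Omega_t,\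 P\in\mathbb P_t(\omega)\}$ is an analytic subset of $\Omega_t\times\mathfrak P(\Omega_{T-t})$, then the graph $\{(\omega,Q):\omega\in\Omega_t,\ Q\in\mathcal M_t(\omega)\}$ is an analytic subset of $\Omega_t\times\mathfrak P(\Omega_{T-t})$ as well. -/

import Mathlib

open MeasureTheory
open scoped ENNReal NNReal

namespace RobustMarket

/-- The universal completion of the `σ`-algebra of `α`: the sets that are measurable for the
completion of every finite measure. -/
@[reducible] def universalCompletion (α : Type*) [MeasurableSpace α] : MeasurableSpace α where
  MeasurableSet' s := ∀ μ : Measure α, IsFiniteMeasure μ → NullMeasurableSet s μ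
  measurableSet_empty := fun _ _ => nullMeasurableSet_empty
  measurableSet_compl := fun _ hs μ hμ => (hs μ hμ).compl
  measurableSet_iUnion := fun _ hs μ hμ => NullMeasurableSet.iUnion fun i => hs i μ hμ

/-- Universally measurable functions. -/
def UniversallyMeasurable {α β : Type*} [MeasurableSpace α] [MeasurableSpace β]
    (f : α → β) : Prop :=
  @Measurable α β (universalCompletion α) _ f

/-- The graph of a set-valued map. -/
def graph {α β : Type*} (F : α → Set β) : Set (α × β) := {p | p.2 ∈ F p.1}

variable {E : Type*}

/-- `iteratedIntegral K ω n f` is the iterated integral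
`∫ ⋯ ∫ f (x₁, …, xₙ) K_{t+n-1}(ω, x₁, …, x_{n-1}; dxₙ) ⋯ K_t(ω; dx₁)`. -/
noncomputable def iteratedIntegral [MeasurableSpace E]
    (K : ∀ i : ℕ, (Fin i → E) → ProbabilityMeasure E) {t : ℕ} (ω : Fin t → E) :
    ∀ n : ℕ, ((Fin n → E) → ℝ≥0∞) → ℝ≥0∞
  | 0, f => f Fin.elim0
  | n + 1, f => iteratedIntegral K ω n fun y =>
      ∫⁻ x, f (Fin.snoc (α := fun _ => E) y x) ∂(K (t + n) (Fin.append ω y) : Measure E)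

/-- `IsProduct K ω n R` says that `R = K_t(ω) ⊗ K_{t+1}(ω, ·) ⊗ ⋯ ⊗ K_{t+n-1}(ω, ·)`, as a
probability measure on the `n`-fold product of `E`: the value of `R` at every Borel set is the
iterated integral of its indicator function. -/
def IsProduct [MeasurableSpace E]
    (K : ∀ i : ℕ, (Fin i → E) → ProbabilityMeasure E) {t : ℕ} (ω : Fin t → E)
    (n : ℕ) (R : ProbabilityMeasure (Fin n → E)) : Prop :=
  ∀ A : Set (Fin n → E), MeasurableSet A →
    (R : Measure (Fin n → E)) A = iteratedIntegral K ω n (A.indicator fun _ => 1)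

/-- `IsSelector F κ`: `κ` is a universally measurable kernel with `κ ω ∈ F ω` on the set where
`F ω` is nonempty. -/
def IsSelector {α : Type*} [MeasurableSpace α] [MeasurableSpace E]
    (F : α → Set (ProbabilityMeasure E)) (κ : α → ProbabilityMeasure E) : Prop :=
  UniversallyMeasurable κ ∧ ∀ ω, (F ω).Nonempty → κ ω ∈ F ω

/-- The multi-period models from time `t` to time `T`, in the state `ω` at time `t`: all products
`P_t ⊗ ⋯ ⊗ P_{T-1}` at `ω` of universally measurable selectors `P_i` of `Mod i`. -/
def models [MeasurableSpace E] (Mod : ∀ i : ℕ, (Fin i → E) → Set (ProbabilityMeasure E))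
    (T t : ℕ) (ω : Fin t → E) : Set (ProbabilityMeasure (Fin (T - t) → E)) :=
  {R | ∃ P : ∀ i : ℕ, (Fin i → E) → ProbabilityMeasure E,
    (∀ i, t ≤ i → i < T → UniversallyMeasurable (P i) ∧ ∀ η, P i η ∈ Mod i η) ∧
    IsProduct P ω (T - t) R}

/-- The one-period martingale measures dominated by a model in `Mod i ω`. The expectation of the
increment being zero includes its integrability. -/
def oneStepMartingaleMeasures [MeasurableSpace E]
    (Mod : ∀ i : ℕ, (Fin i → E) → Set (ProbabilityMeasure E)) (S : ∀ i : ℕ, (Fin i → E) → ℝ)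
    (i : ℕ) (ω : Fin i → E) : Set (ProbabilityMeasure E) :=
  {Q | (∃ P ∈ Mod i ω, (Q : Measure E) ≪ (P : Measure E)) ∧
    Integrable (fun x => S (i + 1) (Fin.snoc (α := fun _ => E) ω x) - S i ω) (Q : Measure E) ∧
    ∫ x, (S (i + 1) (Fin.snoc (α := fun _ => E) ω x) - S i ω) ∂(Q : Measure E) = 0}

/-- The dominated martingale measures from time `t` to time `T`, in the state `ω` at time `t`: all
products `Q_t ⊗ ⋯ ⊗ Q_{T-1}` at `ω` of universally measurable selectors `Q_i` of the one-period
martingale measures. A selector is only determined by the market on the set of states that have a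
one-period martingale measure, and the product has to be carried by paths that stay in these
sets at the times `t, …, T - 1` (the last clause, with `i = t + k`), so that the arbitrary values
of the `Q_i` outside of them are never used. -/
def martingaleMeasures [MeasurableSpace E]
    (Mod : ∀ i : ℕ, (Fin i → E) → Set (ProbabilityMeasure E)) (S : ∀ i : ℕ, (Fin i → E) → ℝ)
    (T t : ℕ) (ω : Fin t → E) : Set (ProbabilityMeasure (Fin (T - t) → E)) :=
  {R | ∃ Q : ∀ i : ℕ, (Fin i → E) → ProbabilityMeasure E,
    (∀ i, t ≤ i → i < T → IsSelector (oneStepMartingaleMeasures Mod S i) (Q i)) ∧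
    IsProduct Q ω (T - t) R ∧
    ∀ (k : ℕ) (hk : k < T - t), ∀ᵐ y ∂(R : Measure (Fin (T - t) → E)),
      (oneStepMartingaleMeasures Mod S (t + k)
        (Fin.append ω fun j : Fin k => y (Fin.castLE hk.le j))).Nonempty}

end RobustMarket

namespace MeasureTheory

open Set Filter Topology TopologicalSpace

/-! ### Analytic sets in standard Borel spaces -/

/-! A measure `R` is a dominated martingale measure at `ω` exactly when, for each `k < T - t`, its
conditional law of the entry with index `k` given the earlier ones lies, `R`-almost surely, in the
one-period set at the current history (`mem_martingaleMeasures_iff`). This trades the existential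
over universally measurable kernels for finitely many almost sure conditions on `R`. Conditional
laws can be chosen jointly Borel in `R` and the history (`condLaw`), so each condition says that a
section of an analytic set has full measure under `R`. The pairs `(ω, R)` with this property form an
analytic set (`AnalyticSet.setOf_ae_mem`), and so does a finite intersection of such sets.

The one-period graphs are analytic because absolute continuity, integrability and zero mean are
Borel conditions on `(ω, Q, P)`, and the dominating `P` is projected out. To recover kernels from
`R`, its conditional laws are kept where they are one-period martingale measures and replaced by a
Jankov–von Neumann selector elsewhere. Throughout, the space of probability measures has to be
standard Borel, which comes from embedding the state space in the Hilbert cube. -/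

theorem analyticSet_of_measurableSet {X : Type*} [TopologicalSpace X]
    [SecondCountableTopology X] [MeasurableSpace X] [OpensMeasurableSpace X] [StandardBorelSpace X]
    {s : Set X} (hs : MeasurableSet s) : AnalyticSet s := by
  simpa using hs.analyticSet_image measurable_id

/-- Preimages of analytic sets under Borel maps between standard Borel spaces are analytic. -/
theorem AnalyticSet.preimage_of_measurable {X Y : Type*} [TopologicalSpace X]
    [SecondCountableTopology X] [MeasurableSpace X] [OpensMeasurableSpace X] [StandardBorelSpace X]
    [TopologicalSpace Y] [T2Space Y] [SecondCountableTopology Y] [MeasurableSpace Y] [BorelSpace Y]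
    {s : Set Y} (hs : AnalyticSet s) {f : X → Y} (hf : Measurable f) : AnalyticSet (f ⁻¹' s) := by
  -- With `s` the range of a continuous `g`, the preimage is the projection of the Borel set where
  -- `f` and `g` agree.
  obtain ⟨Z, _, _, g, hg, rfl⟩ := analyticSet_iff_exists_polishSpace_range.1 hs
  let _ : MeasurableSpace Z := borel Z
  have : BorelSpace Z := ⟨rfl⟩
  have h : MeasurableSet {p : X × Z | f p.1 = g p.2} :=
    measurableSet_eq_fun (hf.comp measurable_fst) (hg.measurable.comp measurable_snd)
  convert! h.analyticSet_image measurable_fst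
  ext x
  simp [eq_comm]

theorem AnalyticSet.inter {X : Type*} [TopologicalSpace X] [T2Space X] {s t : Set X}
    (hs : AnalyticSet s) (ht : AnalyticSet t) : AnalyticSet (s ∩ t) := by
  rw [inter_eq_iInter]
  exact AnalyticSet.iInter fun b => by cases b <;> assumption

/-! ### Cylinders of the Baire space -/

/-- The sequences of natural numbers with initial segment `u`. -/
def prefixCylinder (u : List ℕ) : Set (ℕ → ℕ) := {z | (List.range u.length).map z = u}

theorem prefixCylinder_nil : prefixCylinder [] = univ := by
  ext z; simp [prefixCylinder]

theorem mem_prefixCylinder_append {u : List ℕ} {k : ℕ} {z : ℕ → ℕ} :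
    z ∈ prefixCylinder (u ++ [k]) ↔ z ∈ prefixCylinder u ∧ z u.length = k := by
  simp [prefixCylinder, List.range_succ]

theorem prefixCylinder_eq_iUnion (u : List ℕ) :
    prefixCylinder u = ⋃ k, prefixCylinder (u ++ [k]) := by
  ext z
  simp [mem_prefixCylinder_append]

theorem mem_prefixCylinder_map_range {y z : ℕ → ℕ} {n : ℕ} :
    y ∈ prefixCylinder ((List.range n).map z) ↔ ∀ i < n, y i = z i := by
  simp [prefixCylinder]

/-- The cylinders around a point form a neighbourhood basis. -/
theorem exists_prefixCylinder_subset {z : ℕ → ℕ} {U : Set (ℕ → ℕ)} (hU : U ∈ 𝓝 z) :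
    ∃ n, prefixCylinder ((List.range n).map z) ⊆ U := by
  by_contra! h
  choose y hy hyU using fun n => not_subset.1 (h n)
  have : Tendsto y atTop (𝓝 z) := by
    rw [tendsto_pi_nhds]
    intro i
    refine tendsto_const_nhds.congr' ?_
    filter_upwards [eventually_gt_atTop i] with n hn
    exact (mem_prefixCylinder_map_range.1 (hy n) i hn).symm
  obtain ⟨n, hn⟩ := (this.eventually hU).exists
  exact hyU n hn

/-! ### Universal measurability of analytic sets -/

/-- Analytic subsets of a regular space are measurable for the completion of every finite Borel
measure. -/
theorem AnalyticSet.nullMeasurableSet {X : Type*} [TopologicalSpace X] [T2Space X] [RegularSpace X]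
    [MeasurableSpace X] [OpensMeasurableSpace X] {s : Set X} (hs : AnalyticSet s)
    (μ : Measure X) [IsFiniteMeasure μ] : NullMeasurableSet s μ := by
  rw [AnalyticSet] at hs
  obtain rfl | ⟨f, hf, rfl⟩ := hs
  · exact nullMeasurableSet_empty
  let A : List ℕ → Set X := fun u => f '' prefixCylinder u
  -- The envelope keeps the outer measure of `A u`; the closure forces a point lying in `H` along a
  -- whole branch to be the image of that branch.
  let H : List ℕ → Set X := fun u => toMeasurable μ (A u) ∩ closure (A u)
  have hA (u) : A u = ⋃ k, A (u ++ [k]) := by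
    simp only [A]
    rw [← image_iUnion, ← prefixCylinder_eq_iUnion]
  have hH (u) : MeasurableSet (H u) :=
    (measurableSet_toMeasurable _ _).inter isClosed_closure.measurableSet
  have hAH (u) : A u ⊆ H u := subset_inter (subset_toMeasurable _ _) subset_closure
  have hμH (u) : μ (H u) = μ (A u) :=
    le_antisymm ((measure_mono inter_subset_left).trans (measure_toMeasurable _).le)
      (measure_mono (hAH u))
  -- The children of `H u` cover `A u`, and `A u` already has the full outer measure of `H u`.
  have hnull (u) : μ (H u \ ⋃ k, H (u ++ [k])) = 0 := by
    have hm : MeasurableSet (⋃ k, H (u ++ [k])) := MeasurableSet.iUnion fun k => hH _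
    have hsub : A u ⊆ H u ∩ ⋃ k, H (u ++ [k]) :=
      subset_inter (hAH u) ((hA u).le.trans (iUnion_mono fun k => hAH _))
    have h1 := measure_inter_add_sdiff (μ := μ) (H u) hm
    have h2 : μ (H u ∩ ⋃ k, H (u ++ [k])) = μ (H u) :=
      le_antisymm (measure_mono inter_subset_left) ((hμH u).le.trans (measure_mono hsub))
    rw [h2] at h1
    exact (ENNReal.add_right_inj (measure_ne_top μ (H u))).1 (by rw [h1, add_zero])
  have hN : μ (⋃ u, H u \ ⋃ k, H (u ++ [k])) = 0 := measure_iUnion_null hnull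
  have hrange : A [] = range f := by simp [A, prefixCylinder_nil]
  refine (hH []).nullMeasurableSet.congr ?_
  rw [← hrange]
  refine Filter.EventuallyLE.antisymm ?_ (LE.le.eventuallyLE (hAH []))
  refine ae_le_set.2 (measure_mono_null ?_ hN)
  rintro x ⟨hx, hxA⟩
  by_contra hxN
  -- Off the null set, membership in `H u` passes to some child, so `x` can be followed along an
  -- infinite branch `z`.
  simp only [mem_iUnion, Set.mem_sdiff, not_exists, not_and, not_forall, not_not] at hxN
  choose! k hk using hxN
  let p : ℕ → List ℕ := fun n => Nat.rec [] (fun _ u => u ++ [k u]) n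
  let z : ℕ → ℕ := fun n => k (p n)
  have hp (n) : p n = (List.range n).map z := by
    induction n with
    | zero => rfl
    | succ n ih => simp [List.range_succ, ← ih, p, z]
  have hxH (n) : x ∈ H (p n) := by
    induction n with
    | zero => exact hx
    | succ n ih => exact hk _ ih
  refine hxA ?_
  rw [hrange]
  refine ⟨z, ?_⟩
  by_contra hne
  have hd : ({x}ᶜ : Set X) ∈ 𝓝 (f z) := isOpen_compl_singleton.mem_nhds hne
  -- Regularity gives a closed neighbourhood of `f z` that misses `x` but contains the closure of `A
  -- (p n)` for large `n`.
  obtain ⟨C, hC, hCc, hCx⟩ := exists_mem_nhds_isClosed_subset hd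
  obtain ⟨n, hn⟩ := exists_prefixCylinder_subset (hf.continuousAt.preimage_mem_nhds hC)
  have : x ∈ closure (A (p n)) := (hxH n).2
  rw [hp] at this
  exact hCx (hCc.closure_subset_iff.2 (image_subset_iff.2 hn) this) rfl

/-- The universal completion contains the analytic sets. -/
theorem AnalyticSet.measurableSet_universalCompletion {X : Type*} [TopologicalSpace X] [T2Space X]
    [RegularSpace X] [MeasurableSpace X] [OpensMeasurableSpace X] {s : Set X} (hs : AnalyticSet s) :
    MeasurableSet[RobustMarket.universalCompletion X] s :=
  fun μ _ => hs.nullMeasurableSet μ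

/-! ### Measurable selection -/

theorem measurable_sInf_nat {X : Type*} [MeasurableSpace X] {B : ℕ → Set X}
    (hB : ∀ k, MeasurableSet (B k)) : Measurable fun x => sInf {k | x ∈ B k} := by
  refine measurable_to_countable' fun k => ?_
  have : (fun x => sInf {k | x ∈ B k}) ⁻¹' {k} =
      -- The second piece collects the points in no `B j`, where `sInf ∅ = 0`.
      (B k ∩ ⋂ j, ⋂ (_ : j < k), (B j)ᶜ) ∪ ({_x | k = 0} ∩ ⋂ j, (B j)ᶜ) := by
    ext x
    simp only [mem_preimage, mem_singleton_iff, mem_union, mem_inter_iff, mem_iInter,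
      mem_compl_iff]
    constructor
    · rintro rfl
      rcases ({k | x ∈ B k} : Set ℕ).eq_empty_or_nonempty with h | h
      · right
        refine ⟨by simp [h], fun j hj => ?_⟩
        have : j ∈ {k | x ∈ B k} := hj
        simp [h] at this
      · exact Or.inl ⟨Nat.sInf_mem h, fun j hj => Nat.notMem_of_lt_sInf hj⟩
    · rintro (⟨h1, h2⟩ | ⟨h1, h2⟩)
      · refine le_antisymm (Nat.sInf_le h1) ?_
        by_contra! hlt
        exact h2 _ hlt (Nat.sInf_mem (s := {k | x ∈ B k}) ⟨k, h1⟩)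
      · have : {k | x ∈ B k} = ∅ := by ext j; simpa using h2 j
        have h1 : k = 0 := h1
        simp [this, h1]
  rw [this]
  refine ((hB k).inter ?_).union ((MeasurableSet.const _).inter ?_)
  · exact MeasurableSet.iInter fun j => MeasurableSet.iInter fun _ => (hB j).compl
  · exact MeasurableSet.iInter fun j => (hB j).compl

theorem isClosed_prefixCylinder (u : List ℕ) : IsClosed (prefixCylinder u) := by
  induction u using List.reverseRecOn with
  | nil => simp [prefixCylinder_nil]
  | append_singleton u k ih =>
    have : prefixCylinder (u ++ [k]) = prefixCylinder u ∩ {z | z u.length = k} := by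
      ext z; exact mem_prefixCylinder_append
    rw [this]
    exact ih.inter (isClosed_eq (continuous_apply _) continuous_const)

/-- The leftmost points of the fibres of a continuous map on the Baire space form a measurable
right inverse, for every `σ`-algebra that contains the analytic sets. -/
theorem exists_measurable_rightInverse {X : Type*} [TopologicalSpace X] [T2Space X] [RegularSpace X]
    {m : MeasurableSpace X} (hm : ∀ s : Set X, AnalyticSet s → MeasurableSet s)
    {g : (ℕ → ℕ) → X} (hg : Continuous g) :
    ∃ σ : X → ℕ → ℕ, Measurable σ ∧ ∀ x ∈ range g, g (σ x) = x := by
  let A : List ℕ → Set X := fun u => g '' prefixCylinder u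
  have hA (u) : MeasurableSet (A u) :=
    hm _ ((isClosed_prefixCylinder u).analyticSet.image_of_continuous hg)
  have hAU (u) : A u = ⋃ k, A (u ++ [k]) := by
    simp only [A]
    rw [← image_iUnion, ← prefixCylinder_eq_iUnion]
  -- For `x` in `A u` the infimum is attained, by the splitting of `A u`; its default value `0`
  -- matters only off the range of `g`.
  let next : List ℕ → X → ℕ := fun u x => sInf {k | x ∈ A (u ++ [k])}
  have hnext (u) : Measurable (next u) := measurable_sInf_nat fun k => hA _
  let p : ℕ → X → List ℕ := fun n x => Nat.rec [] (fun _ u => u ++ [next u x]) n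
  let σ : X → ℕ → ℕ := fun x n => next (p n x) x
  have hp (x) (n) : p n x = (List.range n).map (σ x) := by
    induction n with
    | zero => rfl
    | succ n ih => simp [List.range_succ, ← ih, p, σ]
  have hpm (n) (u : List ℕ) : MeasurableSet {x | p n x = u} := by
    induction n generalizing u with
    | zero => exact MeasurableSet.const ([] = u)
    | succ n ih =>
      have : {x | p (n + 1) x = u} =
          ⋃ v : List ℕ, {x | p n x = v} ∩ ⋃ k : ℕ, (next v ⁻¹' {k} ∩ {_x | v ++ [k] = u}) := by
        ext x
        simp [p]
      rw [this]
      exact MeasurableSet.iUnion fun v => (ih v).inter <| MeasurableSet.iUnion fun k =>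
        (hnext v (measurableSet_singleton k)).inter (MeasurableSet.const _)
  refine ⟨σ, measurable_pi_iff.2 fun n => measurable_to_countable' fun k => ?_, ?_⟩
  · have : (fun x => σ x n) ⁻¹' {k} = ⋃ v : List ℕ, {x | p n x = v} ∩ next v ⁻¹' {k} := by
      ext x
      simp [σ]
    rw [this]
    exact MeasurableSet.iUnion fun v => (hpm n v).inter (hnext v (measurableSet_singleton k))
  · intro x hx
    have hxA (n) : x ∈ A (p n x) := by
      induction n with
      | zero => simpa [A, p, prefixCylinder_nil] using hx
      | succ n ih =>
        rw [hAU, mem_iUnion] at ih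
        exact Nat.sInf_mem (s := {k | x ∈ A (p n x ++ [k])}) ih
    by_contra hne
    have hd : ({x}ᶜ : Set X) ∈ 𝓝 (g (σ x)) := isOpen_compl_singleton.mem_nhds hne
    obtain ⟨n, hn⟩ := exists_prefixCylinder_subset (hg.continuousAt.preimage_mem_nhds hd)
    obtain ⟨y, hy, hyx⟩ := hxA n
    rw [hp] at hy
    exact hn hy hyx

/-- **Jankov–von Neumann selection theorem**. -/
theorem AnalyticSet.exists_universallyMeasurable_selection {X Z : Type*} [TopologicalSpace X]
    [T2Space X] [RegularSpace X] [MeasurableSpace X] [OpensMeasurableSpace X] [TopologicalSpace Z]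
    [MeasurableSpace Z] [BorelSpace Z] [Nonempty Z] {A : Set (X × Z)} (hA : AnalyticSet A) :
    ∃ s : X → Z, RobustMarket.UniversallyMeasurable s ∧ ∀ x z, (x, z) ∈ A → (x, s x) ∈ A := by
  rw [AnalyticSet] at hA
  obtain rfl | ⟨f, hf, rfl⟩ := hA
  · exact ⟨fun _ => Classical.arbitrary Z,
      @measurable_const _ _ _ (RobustMarket.universalCompletion X) _, by simp⟩
  obtain ⟨σ, hσ, hσg⟩ := exists_measurable_rightInverse
    (m := RobustMarket.universalCompletion X)
    (fun s hs => hs.measurableSet_universalCompletion) (continuous_fst.comp hf)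
  refine ⟨fun x => (f (σ x)).2, (continuous_snd.comp hf).measurable.comp hσ, ?_⟩
  rintro x z ⟨y, hy⟩
  refine ⟨σ x, Prod.ext (hσg x ⟨y, by simp [hy]⟩) rfl⟩

end MeasureTheory

namespace MeasureTheory

open Set Filter Topology TopologicalSpace

/-- The range is Borel, hence carries a Polish topology with the right Borel sets; this topology is
pulled back along the bijection onto the range. -/
theorem standardBorelSpace_of_measurableEmbedding {X Y : Type*} [MeasurableSpace X]
    [MeasurableSpace Y] [StandardBorelSpace Y] {g : X → Y} (hg : MeasurableEmbedding g) :
    StandardBorelSpace X := by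
  have := hg.measurableSet_range.standardBorel
  let _ := upgradeStandardBorel (range g)
  let e := hg.equivRange
  refine ⟨⟨TopologicalSpace.induced e inferInstance, @BorelSpace.mk _ (_) _ ?_,
    e.toEquiv.polishSpace_induced⟩⟩
  rw [borel_comap, ← BorelSpace.measurable_eq]
  exact e.measurableEmbedding.comap_eq.symm

namespace ProbabilityMeasure

/-! ### The Borel structure of the space of probability measures -/

theorem measurable_toMeasure {X : Type*} [MeasurableSpace X] :
    Measurable ((↑) : ProbabilityMeasure X → Measure X) := measurable_subtype_coe

theorem measurable_apply {X : Type*} [MeasurableSpace X] {s : Set X} (hs : MeasurableSet s) :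
    Measurable fun μ : ProbabilityMeasure X => (μ : Measure X) s :=
  (Measure.measurable_coe hs).comp measurable_toMeasure

/-- The topology of weak convergence is generated by the preimages of open sets under the
evaluations at test functions. -/
theorem topology_eq_generateFrom {X : Type*} [TopologicalSpace X] [MeasurableSpace X]
    [OpensMeasurableSpace X] :
    (inferInstance : TopologicalSpace (ProbabilityMeasure X)) =
      generateFrom {s | ∃ (f : BoundedContinuousFunction X ℝ≥0) (U : Set ℝ≥0∞), IsOpen U ∧
        (fun μ : ProbabilityMeasure X => ∫⁻ x, f x ∂(μ : Measure X)) ⁻¹' U = s} := by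
  refine le_antisymm ?_ ?_
  · refine le_generateFrom ?_
    rintro _ ⟨f, U, hU, rfl⟩
    exact hU.preimage (continuous_lintegral_boundedContinuousFunction f)
  · refine continuous_id_iff_le.1 ?_
    refine (@continuous_iff_forall_continuous_lintegral X _ _ _ (ProbabilityMeasure X)
      (generateFrom _) id).2 fun f => ?_
    exact continuous_def.2 fun U hU => isOpen_generateFrom_of_mem ⟨f, U, hU, rfl⟩

/-- If the topology of weak convergence is second countable, then its Borel `σ`-algebra is the
`σ`-algebra generated by the evaluations at Borel sets. -/
theorem borelSpace_of_secondCountable {X : Type*} [TopologicalSpace X] [MeasurableSpace X]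
    [BorelSpace X] [HasOuterApproxClosed X] [SecondCountableTopology (ProbabilityMeasure X)] :
    BorelSpace (ProbabilityMeasure X) := by
  refine ⟨le_antisymm ?_ ?_⟩
  · let m : MeasurableSpace (ProbabilityMeasure X) := borel _
    have : @BorelSpace (ProbabilityMeasure X) _ m := ⟨rfl⟩
    have h : Measurable[m] ((↑) : ProbabilityMeasure X → Measure X) := by
      -- Open sets form a generating π-system, and evaluation at an open set is lower semicontinuous
      -- by the portmanteau theorem.
      refine Measurable.measure_of_isPiSystem_of_isProbabilityMeasure
        (BorelSpace.measurable_eq (α := X)) isPiSystem_isOpen fun G hG => ?_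
      refine LowerSemicontinuous.measurable ?_
      rw [lowerSemicontinuous_iff_le_liminf]
      exact fun μ => le_liminf_measure_open_of_tendsto tendsto_id hG
    exact h.comap_le
  · rw [borel_eq_generateFrom_of_subbasis (topology_eq_generateFrom (X := X))]
    refine MeasurableSpace.generateFrom_le ?_
    rintro _ ⟨f, U, hU, rfl⟩
    have hf : Measurable fun x => (f x : ℝ≥0∞) := by fun_prop
    exact ((Measure.measurable_lintegral hf).comp measurable_toMeasure) hU.measurableSet

/-- The push-forward of probability measures along a topological embedding is an embedding. -/
theorem isEmbedding_map {X Y : Type*} [TopologicalSpace X] [MeasurableSpace X] [BorelSpace X]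
    [HasOuterApproxClosed X] [TopologicalSpace Y] [MeasurableSpace Y] [BorelSpace Y]
    [PseudoMetrizableSpace Y] [SeparableSpace Y] {e : X → Y} (he : IsEmbedding e)
    (hm : MeasurableEmbedding e) :
    IsEmbedding fun μ : ProbabilityMeasure X => μ.map he.continuous.measurable.aemeasurable := by
  refine ⟨isInducing_iff_nhds.2 fun μ => le_antisymm ?_ ?_, fun μ ν h => ?_⟩
  · exact ((continuous_map he.continuous).tendsto μ).le_comap
  · let _ := pseudoMetrizableSpacePseudoMetric (ProbabilityMeasure Y)
    -- Weak convergence can be tested on open sets, each of which is the preimage under `e` of an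
    -- open subset of `Y`.
    refine tendsto_of_forall_isOpen_le_liminf' (μs := id) (L := comap (fun ν :
      ProbabilityMeasure X => ν.map he.continuous.measurable.aemeasurable) (𝓝 _)) fun G hG => ?_
    obtain ⟨U, hU, rfl⟩ := he.isOpen_iff.1 hG
    have h := le_liminf_measure_open_of_tendsto (tendsto_comap (x := 𝓝 (μ.map
      he.continuous.measurable.aemeasurable)) (f := fun ν : ProbabilityMeasure X =>
        ν.map he.continuous.measurable.aemeasurable)) hU
    simpa [Measure.map_apply he.continuous.measurable hU.measurableSet] using h
  · have h' := congrArg ((↑) : ProbabilityMeasure Y → Measure Y) h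
    apply toMeasure_injective
    simp only [toMeasure_map] at h'
    rw [← hm.comap_map (μ : Measure X), h', hm.comap_map]

variable {E : Type*} [TopologicalSpace E] [PolishSpace E] [MeasurableSpace E] [BorelSpace E]

/-- Reduces questions about measures on `E` to the Hilbert cube, whose space of probability measures
is compact and metrizable. -/
theorem exists_embedding_standardBorel :
    ∃ e : E → ℕ → unitInterval, IsEmbedding e ∧ MeasurableEmbedding e := by
  let _ := upgradeIsCompletelyMetrizable E
  obtain ⟨e, he⟩ := Metric.PiNatEmbed.exists_embedding_to_hilbert_cube (X := E)
  exact ⟨e, he, he.continuous.measurableEmbedding he.injective⟩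

instance instSecondCountableTopology : SecondCountableTopology (ProbabilityMeasure E) := by
  obtain ⟨e, he, hm⟩ := exists_embedding_standardBorel (E := E)
  let _ := metrizableSpaceMetric (ProbabilityMeasure (ℕ → unitInterval))
  exact (isEmbedding_map he hm).secondCountableTopology

instance instBorelSpace : BorelSpace (ProbabilityMeasure E) :=
  borelSpace_of_secondCountable

instance instStandardBorelSpace : StandardBorelSpace (ProbabilityMeasure E) := by
  obtain ⟨e, he, hm⟩ := exists_embedding_standardBorel (E := E)
  let _ := metrizableSpaceMetric (ProbabilityMeasure (ℕ → unitInterval))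
  let F := fun μ : ProbabilityMeasure E => μ.map he.continuous.measurable.aemeasurable
  have hF : IsEmbedding F := isEmbedding_map he hm
  -- A measure on the cube comes from `E` as soon as it gives no mass to the complement of `range
  -- e`, which is a Borel condition.
  have hr : range F =
      {ν : ProbabilityMeasure (ℕ → unitInterval) | (ν : Measure _) (range e)ᶜ = 0} := by
    ext ν
    constructor
    · rintro ⟨μ, rfl⟩
      simp [F, Measure.map_apply hm.measurable hm.measurableSet_range.compl]
    · intro hν
      have h : ((ν : Measure (ℕ → unitInterval)).comap e).map e = ν := by
        rw [hm.map_comap, Measure.restrict_eq_self_of_ae_mem]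
        exact hν
      have : IsProbabilityMeasure ((ν : Measure (ℕ → unitInterval)).comap e) := by
        rw [← Measure.isProbabilityMeasure_map_iff hm.measurable.aemeasurable, h]
        infer_instance
      exact ⟨⟨_, this⟩, toMeasure_injective ((toMeasure_map _ _).trans h)⟩
  have hrm : MeasurableSet (range F) := by
    rw [hr]
    exact measurable_apply hm.measurableSet_range.compl (measurableSet_singleton 0)
  have : BorelSpace (ProbabilityMeasure (ℕ → unitInterval)) := borelSpace_of_secondCountable
  have : CompleteSpace (ProbabilityMeasure (ℕ → unitInterval)) := inferInstance
  have : IsCompletelyMetrizableSpace (ProbabilityMeasure (ℕ → unitInterval)) := inferInstance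
  have : PolishSpace (ProbabilityMeasure (ℕ → unitInterval)) := inferInstance
  exact standardBorelSpace_of_measurableEmbedding (hF.measurableEmbedding hrm)

end ProbabilityMeasure
end MeasureTheory

/-! ### Kernels and the full-measure theorem for analytic sections -/

namespace MeasureTheory

open Set Filter Topology TopologicalSpace ProbabilityTheory

namespace ProbabilityMeasure

/-- A measurable map into the space of probability measures, as a Markov kernel. -/
noncomputable def toKernel {α X : Type*} [MeasurableSpace α] [MeasurableSpace X]
    (f : α → ProbabilityMeasure X) (hf : Measurable f) : Kernel α X :=
  ⟨fun a => f a, measurable_toMeasure.comp hf⟩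

@[simp] theorem toKernel_apply {α X : Type*} [MeasurableSpace α] [MeasurableSpace X]
    (f : α → ProbabilityMeasure X) (hf : Measurable f) (a : α) : toKernel f hf a = f a := rfl

instance {α X : Type*} [MeasurableSpace α] [MeasurableSpace X]
    (f : α → ProbabilityMeasure X) (hf : Measurable f) : IsMarkovKernel (toKernel f hf) :=
  ⟨fun a => inferInstanceAs (IsProbabilityMeasure (f a : Measure X))⟩

/-- The values of a Markov kernel, as probability measures. -/
def ofKernel {α X : Type*} [MeasurableSpace α] [MeasurableSpace X] (κ : Kernel α X)
    [IsMarkovKernel κ] (a : α) : ProbabilityMeasure X := ⟨κ a, inferInstance⟩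

@[simp] theorem coe_ofKernel {α X : Type*} [MeasurableSpace α] [MeasurableSpace X]
    (κ : Kernel α X) [IsMarkovKernel κ] (a : α) : (ofKernel κ a : Measure X) = κ a := rfl

theorem measurable_ofKernel {α X : Type*} [MeasurableSpace α] [MeasurableSpace X]
    (κ : Kernel α X) [IsMarkovKernel κ] : Measurable (ofKernel κ) :=
  κ.measurable.subtype_mk

theorem measurable_map {X Y : Type*} [MeasurableSpace X] [MeasurableSpace Y] {f : X → Y}
    (hf : Measurable f) :
    Measurable fun μ : ProbabilityMeasure X => μ.map hf.aemeasurable :=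
  ((Measure.measurable_map f hf).comp measurable_toMeasure).subtype_mk

end ProbabilityMeasure

/-- Null measurability is what analytic sets offer: they need not be Borel. -/
theorem ae_map_of_nullMeasurableSet {α β : Type*} [MeasurableSpace α] [MeasurableSpace β]
    {μ : Measure α} {f : α → β} (hf : AEMeasurable f μ) {s : Set β}
    (hs : NullMeasurableSet s (μ.map f)) (h : ∀ᵐ a ∂μ, f a ∈ s) : ∀ᵐ b ∂μ.map f, b ∈ s := by
  have : μ.map f sᶜ = 0 := by
    rw [Measure.map_apply₀ hf hs.compl]
    exact h
  exact this

theorem _root_.RobustMarket.UniversallyMeasurable.aemeasurable {α β : Type*} [MeasurableSpace α]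
    [MeasurableSpace β] [MeasurableSpace.CountablyGenerated β] {f : α → β}
    (hf : RobustMarket.UniversallyMeasurable f) (μ : Measure α) [IsFiniteMeasure μ] :
    AEMeasurable f μ :=
  NullMeasurable.aemeasurable (fun _ hs => hf hs μ inferInstance)

theorem _root_.Measurable.universallyMeasurable {α β : Type*} [MeasurableSpace α]
    [MeasurableSpace β] {f : α → β} (hf : Measurable f) : RobustMarket.UniversallyMeasurable f :=
  fun _ hs _ _ => (hf hs).nullMeasurableSet

/-- **Kondô–Tugué theorem** for sets of full measure: if `B` is analytic, then so is the set of
points at which the section of `B` has full measure. -/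
theorem AnalyticSet.setOf_ae_mem {X Y : Type*} [TopologicalSpace X] [T2Space X]
    [SecondCountableTopology X] [MeasurableSpace X] [BorelSpace X] [StandardBorelSpace X]
    [TopologicalSpace Y] [PolishSpace Y] [MeasurableSpace Y] [BorelSpace Y]
    {B : Set (X × Y)} (hB : AnalyticSet B) (η : Kernel X Y) [IsMarkovKernel η] :
    AnalyticSet {x | ∀ᵐ y ∂η x, (x, y) ∈ B} := by
  obtain rfl | ⟨f, hf, rfl⟩ := (by rwa [AnalyticSet] at hB :
    B = ∅ ∨ ∃ f : (ℕ → ℕ) → X × Y, Continuous f ∧ range f = B)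
  · simp [NeZero.ne, analyticSet_empty]
  have hf₁ : Measurable fun z => (f z).1 := (continuous_fst.comp hf).measurable
  have hf₂ : Measurable fun z => (f z).2 := (continuous_snd.comp hf).measurable
  let ν : Kernel (X × ProbabilityMeasure (ℕ → ℕ)) (ℕ → ℕ) :=
    ProbabilityMeasure.toKernel Prod.snd measurable_snd
  -- The section at `x` has full measure iff `η x` lifts to a law on the Baire space whose image
  -- under `f` is carried by the fibre over `x`. Such lifts satisfy Borel conditions, and `S` is
  -- projected to `X`.
  let S : Set (X × ProbabilityMeasure (ℕ → ℕ)) :=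
    {p | p.2.map hf₂.aemeasurable = ProbabilityMeasure.ofKernel η p.1} ∩
      {p | ν p (Prod.mk p ⁻¹' {q | (f q.2).1 ≠ q.1.1}) = 0}
  have hS : MeasurableSet S := by
    refine (measurableSet_eq_fun ((ProbabilityMeasure.measurable_map hf₂).comp measurable_snd)
      ((ProbabilityMeasure.measurable_ofKernel η).comp measurable_fst)).inter ?_
    refine Kernel.measurable_kernel_prodMk_left ?_ (measurableSet_singleton 0)
    exact (measurableSet_eq_fun (hf₁.comp measurable_snd)
      (measurable_fst.comp measurable_fst)).compl
  convert! hS.analyticSet_image measurable_fst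
  ext x
  have hsec : AnalyticSet {y | (x, y) ∈ range f} := hB.preimage (by fun_prop)
  simp only [mem_ofPred_eq, mem_image, Prod.exists, exists_and_right, exists_eq_right]
  constructor
  · intro hx
    have hA : AnalyticSet {p : Y × (ℕ → ℕ) | f p.2 = (x, p.1)} :=
      (isClosed_eq (by fun_prop) (by fun_prop)).analyticSet
    -- A universally measurable choice of preimages of `(x, y)` under `f` pushes `η x` forward to
    -- the required lift.
    obtain ⟨s, hs, hsA⟩ := hA.exists_universallyMeasurable_selection
    have hs' : AEMeasurable s (ProbabilityMeasure.ofKernel η x : Measure Y) := hs.aemeasurable _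
    have hfs : ∀ᵐ y ∂η x, f (s y) = (x, y) := by
      filter_upwards [hx] with y ⟨z, hz⟩
      exact hsA y z hz
    refine ⟨(ProbabilityMeasure.ofKernel η x).map hs', ?_, ?_⟩
    · apply ProbabilityMeasure.toMeasure_injective
      rw [ProbabilityMeasure.toMeasure_map, ProbabilityMeasure.toMeasure_map,
        AEMeasurable.map_map_of_aemeasurable hf₂.aemeasurable hs', ProbabilityMeasure.coe_ofKernel]
      conv_rhs => rw [← Measure.map_id (μ := η x)]
      refine Measure.map_congr ?_
      filter_upwards [hfs] with y hy
      simp [hy]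
    · change ∀ᵐ z ∂((ProbabilityMeasure.ofKernel η x).map hs' : Measure (ℕ → ℕ)), (f z).1 = x
      rw [ProbabilityMeasure.toMeasure_map]
      refine ae_map_of_nullMeasurableSet hs' (s := {z | (f z).1 = x})
        (measurableSet_eq_fun hf₁ measurable_const).nullMeasurableSet ?_
      filter_upwards [hfs] with y hy
      simp [hy]
  · rintro ⟨μ, h₁, h₂⟩
    have h₁' := congrArg ((↑) : ProbabilityMeasure Y → Measure Y) h₁
    simp only [ProbabilityMeasure.toMeasure_map, ProbabilityMeasure.coe_ofKernel] at h₁'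
    rw [← h₁']
    refine ae_map_of_nullMeasurableSet hf₂.aemeasurable (hsec.nullMeasurableSet _) ?_
    have h₂' : ∀ᵐ z ∂(μ : Measure (ℕ → ℕ)), (f z).1 = x := h₂
    filter_upwards [h₂'] with z hz
    exact ⟨z, Prod.ext hz rfl⟩

end MeasureTheory

namespace RobustMarket

open Set Filter ProbabilityTheory

theorem UniversallyMeasurable.comp_measurable {α β γ : Type*} [MeasurableSpace α]
    [MeasurableSpace β] [MeasurableSpace γ] {f : β → γ} (hf : UniversallyMeasurable f) {g : α → β}
    (hg : Measurable g) : UniversallyMeasurable (f ∘ g) := by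
  intro s hs μ hμ
  have : IsFiniteMeasure (μ.map g) := inferInstance
  exact (hf hs (μ.map g) this).preimage (hg.quasiMeasurePreserving μ)

/-! ### Splitting off the last coordinate -/

section Split

/-- A sequence of length `n + 1`, split into its first `n` entries and the last one. -/
def splitLast {E : Type*} (n : ℕ) (y : Fin (n + 1) → E) : (Fin n → E) × E :=
  (Fin.init (α := fun _ => E) y, y (Fin.last n))

@[simp] theorem snoc_splitLast {E : Type*} {n : ℕ} (y : Fin (n + 1) → E) :
    Fin.snoc (α := fun _ => E) (splitLast n y).1 (splitLast n y).2 = y :=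
  Fin.snoc_init_self y

variable {E : Type*} [MeasurableSpace E]

theorem measurable_snoc {n : ℕ} :
    Measurable fun p : (Fin n → E) × E => Fin.snoc (α := fun _ => E) p.1 p.2 := by
  refine measurable_pi_iff.2 fun i => ?_
  induction i using Fin.lastCases with
  | last => simpa using measurable_snd
  | cast i => simpa [Function.comp_def] using (measurable_pi_apply i).comp measurable_fst

theorem measurable_init {n : ℕ} :
    Measurable fun y : Fin (n + 1) → E => Fin.init (α := fun _ => E) y :=
  measurable_pi_iff.2 fun i => measurable_pi_apply i.castSucc

theorem measurable_splitLast {n : ℕ} : Measurable (splitLast (E := E) n) :=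
  measurable_init.prodMk (measurable_pi_apply _)

theorem measurable_append {m n : ℕ} : Measurable fun p : (Fin m → E) × (Fin n → E) =>
    Fin.append p.1 p.2 := by
  refine measurable_pi_iff.2 fun i => ?_
  induction i using Fin.addCases with
  | left i => simpa [Function.comp_def] using (measurable_pi_apply i).comp measurable_fst
  | right i => simpa [Function.comp_def] using (measurable_pi_apply i).comp measurable_snd

theorem map_snoc_map_splitLast {n : ℕ} (ρ : Measure (Fin (n + 1) → E)) :
    (ρ.map (splitLast n)).map (fun p => Fin.snoc (α := fun _ => E) p.1 p.2) = ρ := by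
  rw [Measure.map_map measurable_snoc measurable_splitLast]
  have : (fun p : (Fin n → E) × E => Fin.snoc (α := fun _ => E) p.1 p.2) ∘ splitLast n = id := by
    ext1 y; simp
  rw [this, Measure.map_id]

theorem fst_map_splitLast {n : ℕ} (ρ : Measure (Fin (n + 1) → E)) :
    (ρ.map (splitLast n)).fst = ρ.map (fun y => Fin.init (α := fun _ => E) y) := by
  rw [Measure.fst, Measure.map_map measurable_fst measurable_splitLast]
  rfl

end Split

/-! ### Product measures -/

section Product

variable {E : Type*} [MeasurableSpace E] {K : ∀ i : ℕ, (Fin i → E) → ProbabilityMeasure E}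
  {t : ℕ} {ω : Fin t → E} {n : ℕ}

/-- The marginal of a product measure is a product measure. -/
theorem IsProduct.map_init {ρ : ProbabilityMeasure (Fin (n + 1) → E)}
    (h : IsProduct K ω (n + 1) ρ) : IsProduct K ω n (ρ.map measurable_init.aemeasurable) := by
  intro A hA
  rw [ProbabilityMeasure.toMeasure_map, Measure.map_apply measurable_init hA,
    h _ (measurable_init hA), iteratedIntegral]
  congr 1
  ext y
  -- The indicator ignores the last entry, and the last kernel has mass one.
  have (x : E) : ((fun y : Fin (n + 1) → E => Fin.init (α := fun _ => E) y) ⁻¹' A).indicator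
      (fun _ => (1 : ℝ≥0∞)) (Fin.snoc (α := fun _ => E) y x) = A.indicator (fun _ => 1) y := by
    change A.indicator (fun _ => 1) (Fin.init (α := fun _ => E) (Fin.snoc y x)) = _
    rw [Fin.init_snoc]
  simp [this]

theorem isProduct_zero (ρ : ProbabilityMeasure (Fin 0 → E)) : IsProduct K ω 0 ρ := by
  intro A hA
  rw [iteratedIntegral, ← lintegral_indicator_one hA, lintegral_unique]
  simp [Subsingleton.elim (default : Fin 0 → E) Fin.elim0]
  rfl

/-- The iterated integral with respect to kernels that agree almost everywhere. -/
theorem ae_lintegral_snoc_congr {ρ : Measure (Fin (n + 1) → E)} [IsFiniteMeasure ρ]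
    {k : (Fin n → E) → ProbabilityMeasure E} {κ : Kernel (Fin n → E) E} [IsMarkovKernel κ]
    (hκ : ∀ᵐ y ∂(ρ.map fun y => Fin.init (α := fun _ => E) y), (k y : Measure E) = κ y)
    (hρ : ρ.map (splitLast n) = (ρ.map fun y => Fin.init (α := fun _ => E) y) ⊗ₘ κ)
    {g g' : (Fin (n + 1) → E) → ℝ≥0∞} (hg : g =ᵐ[ρ] g') :
    (fun y => ∫⁻ x, g (Fin.snoc (α := fun _ => E) y x) ∂(k y : Measure E))
      =ᵐ[ρ.map fun y => Fin.init (α := fun _ => E) y]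
    fun y => ∫⁻ x, g' (Fin.snoc (α := fun _ => E) y x) ∂(κ y) := by
  have h : ∀ᵐ p ∂((ρ.map fun y => Fin.init (α := fun _ => E) y) ⊗ₘ κ),
      g (Fin.snoc (α := fun _ => E) p.1 p.2) = g' (Fin.snoc (α := fun _ => E) p.1 p.2) := by
    rw [← hρ]
    refine ae_of_ae_map measurable_snoc.aemeasurable (p := fun y => g y = g' y) ?_
    rwa [map_snoc_map_splitLast]
  filter_upwards [hκ, Measure.ae_ae_of_ae_compProd h] with y hy hy'
  rw [hy]
  exact lintegral_congr_ae hy'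

theorem measurable_lintegral_snoc {κ : Kernel (Fin n → E) E} [IsMarkovKernel κ]
    {g : (Fin (n + 1) → E) → ℝ≥0∞} (hg : Measurable g) :
    Measurable fun y => ∫⁻ x, g (Fin.snoc (α := fun _ => E) y x) ∂(κ y) :=
  Measurable.lintegral_kernel_prod_right' (κ := κ) (hg.comp measurable_snoc)

theorem lintegral_eq_lintegral_snoc {ρ : Measure (Fin (n + 1) → E)} [IsFiniteMeasure ρ]
    {κ : Kernel (Fin n → E) E} [IsMarkovKernel κ]
    (hρ : ρ.map (splitLast n) = (ρ.map fun y => Fin.init (α := fun _ => E) y) ⊗ₘ κ)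
    {g : (Fin (n + 1) → E) → ℝ≥0∞} (hg : Measurable g) :
    ∫⁻ y, g y ∂ρ = ∫⁻ y, ∫⁻ x, g (Fin.snoc (α := fun _ => E) y x) ∂(κ y)
      ∂(ρ.map fun y => Fin.init (α := fun _ => E) y) := by
  conv_lhs => rw [← map_snoc_map_splitLast ρ]
  rw [lintegral_map hg measurable_snoc, hρ]
  exact Measure.lintegral_compProd (hg.comp measurable_snoc)

/-- Integration with respect to a product measure is iterated integration. -/
def HasIteratedIntegral (K : ∀ i : ℕ, (Fin i → E) → ProbabilityMeasure E) (ω : Fin t → E) (n : ℕ)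
    (ρ : Measure (Fin n → E)) : Prop :=
  ∀ g : (Fin n → E) → ℝ≥0∞, AEMeasurable g ρ → iteratedIntegral K ω n g = ∫⁻ y, g y ∂ρ

theorem HasIteratedIntegral.isProduct {ρ : ProbabilityMeasure (Fin n → E)}
    (h : HasIteratedIntegral K ω n ρ) : IsProduct K ω n ρ := by
  intro A hA
  rw [h _ (measurable_const.indicator hA).aemeasurable]
  exact (lintegral_indicator_one hA).symm

/-- The inner integral against `K (t + n)` is almost everywhere equal to a measurable integral
against `κ`. Almost everywhere measurability therefore survives the recursion, although `K` need not
be Borel. -/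
theorem HasIteratedIntegral.succ {ρ : Measure (Fin (n + 1) → E)} [IsFiniteMeasure ρ]
    (h : HasIteratedIntegral K ω n (ρ.map fun y => Fin.init (α := fun _ => E) y))
    {κ : Kernel (Fin n → E) E} [IsMarkovKernel κ]
    (hκ : ∀ᵐ y ∂(ρ.map fun y => Fin.init (α := fun _ => E) y),
      (K (t + n) (Fin.append ω y) : Measure E) = κ y)
    (hρ : ρ.map (splitLast n) = (ρ.map fun y => Fin.init (α := fun _ => E) y) ⊗ₘ κ) :
    HasIteratedIntegral K ω (n + 1) ρ := by
  intro g hg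
  have hae := ae_lintegral_snoc_congr hκ hρ hg.ae_eq_mk
  rw [iteratedIntegral, h _ ⟨_, measurable_lintegral_snoc hg.measurable_mk, hae⟩,
    lintegral_congr_ae hae, ← lintegral_eq_lintegral_snoc hρ hg.measurable_mk]
  exact lintegral_congr_ae hg.ae_eq_mk.symm

/-- A product measure is disintegrated by its last kernel. -/
theorem IsProduct.map_splitLast {ρ : ProbabilityMeasure (Fin (n + 1) → E)}
    (h : IsProduct K ω (n + 1) ρ)
    (hi : HasIteratedIntegral K ω n
      ((ρ : Measure (Fin (n + 1) → E)).map fun y => Fin.init (α := fun _ => E) y))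
    {κ : Kernel (Fin n → E) E} [IsMarkovKernel κ]
    (hκ : ∀ᵐ y ∂((ρ : Measure (Fin (n + 1) → E)).map fun y => Fin.init (α := fun _ => E) y),
      (K (t + n) (Fin.append ω y) : Measure E) = κ y) :
    (ρ : Measure (Fin (n + 1) → E)).map (splitLast n) =
      ((ρ : Measure (Fin (n + 1) → E)).map fun y => Fin.init (α := fun _ => E) y) ⊗ₘ κ := by
  ext A hA
  let A' : Set (Fin (n + 1) → E) := splitLast n ⁻¹' A
  have hA' : MeasurableSet A' := measurable_splitLast hA
  have hind (y) (x) : A'.indicator (fun _ => (1 : ℝ≥0∞)) (Fin.snoc (α := fun _ => E) y x) =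
      (Prod.mk y ⁻¹' A).indicator 1 x := by
    have : splitLast n (Fin.snoc (α := fun _ => E) y x) = (y, x) := by simp [splitLast]
    change A.indicator (fun _ => 1) (splitLast n (Fin.snoc y x)) = A.indicator 1 (y, x)
    rw [this]
    rfl
  have hae : (fun y => ∫⁻ x, A'.indicator (fun _ => (1 : ℝ≥0∞)) (Fin.snoc (α := fun _ => E) y x)
      ∂(K (t + n) (Fin.append ω y) : Measure E))
      =ᵐ[(ρ : Measure (Fin (n + 1) → E)).map fun y => Fin.init (α := fun _ => E) y]
      fun y => κ y (Prod.mk y ⁻¹' A) := by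
    filter_upwards [hκ] with y hy
    simp_rw [hind, hy]
    exact lintegral_indicator_one (measurable_prodMk_left hA)
  rw [Measure.map_apply measurable_splitLast hA, h _ hA', iteratedIntegral,
    hi _ ⟨_, Kernel.measurable_kernel_prodMk_left hA, hae⟩, lintegral_congr_ae hae,
    Measure.compProd_apply hA]

theorem universallyMeasurable_append (hK : UniversallyMeasurable (K (t + n))) :
    UniversallyMeasurable fun y : Fin n → E => K (t + n) (Fin.append ω y) :=
  hK.comp_measurable (measurable_append.comp measurable_prodMk_left)

variable [TopologicalSpace E] [PolishSpace E] [BorelSpace E]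

theorem exists_kernel_ae_eq {k : (Fin n → E) → ProbabilityMeasure E}
    (hk : UniversallyMeasurable k) (μ : Measure (Fin n → E)) [IsFiniteMeasure μ] :
    ∃ κ : Kernel (Fin n → E) E, IsMarkovKernel κ ∧ ∀ᵐ y ∂μ, (k y : Measure E) = κ y := by
  have h := hk.aemeasurable μ
  refine ⟨ProbabilityMeasure.toKernel h.mk h.measurable_mk, inferInstance, ?_⟩
  filter_upwards [h.ae_eq_mk] with y hy
  rw [ProbabilityMeasure.toKernel_apply, ← hy]

/-- `IsProduct` concerns Borel indicators only. The extension to integrands goes by induction: the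
formula for the marginal yields the disintegration by the last kernel, which yields the next
formula. -/
theorem IsProduct.hasIteratedIntegral {ρ : ProbabilityMeasure (Fin n → E)}
    (hK : ∀ k < n, UniversallyMeasurable (K (t + k))) (h : IsProduct K ω n ρ) :
    HasIteratedIntegral K ω n ρ := by
  induction n with
  | zero =>
    intro g _
    rw [iteratedIntegral, lintegral_unique]
    simp [Subsingleton.elim (default : Fin 0 → E) Fin.elim0]
  | succ n ih =>
    have hi := ih (fun k hk => hK k (by omega)) h.map_init
    rw [ProbabilityMeasure.toMeasure_map] at hi
    obtain ⟨κ, hκm, hκ⟩ := exists_kernel_ae_eq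
      (universallyMeasurable_append (ω := ω) (hK n (by omega)))
      ((ρ : Measure (Fin (n + 1) → E)).map fun y => Fin.init (α := fun _ => E) y)
    exact hi.succ hκ (h.map_splitLast hi hκ)

/-- The last kernel of a product measure is its conditional kernel. -/
theorem IsProduct.ae_eq_condKernel [Nonempty E] {ρ : ProbabilityMeasure (Fin (n + 1) → E)}
    (hK : ∀ k < n + 1, UniversallyMeasurable (K (t + k))) (h : IsProduct K ω (n + 1) ρ) :
    ∀ᵐ y ∂((ρ : Measure (Fin (n + 1) → E)).map fun y => Fin.init (α := fun _ => E) y),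
      (K (t + n) (Fin.append ω y) : Measure E) =
        ((ρ : Measure (Fin (n + 1) → E)).map (splitLast n)).condKernel y := by
  have hi := h.map_init.hasIteratedIntegral (fun k hk => hK k (by omega))
  rw [ProbabilityMeasure.toMeasure_map] at hi
  obtain ⟨κ, hκm, hκ⟩ := exists_kernel_ae_eq
    (universallyMeasurable_append (ω := ω) (hK n (by omega)))
    ((ρ : Measure (Fin (n + 1) → E)).map fun y => Fin.init (α := fun _ => E) y)
  have hρ := h.map_splitLast hi hκ
  rw [← fst_map_splitLast] at hρ hκ ⊢
  filter_upwards [hκ, eq_condKernel_of_measure_eq_compProd κ hρ] with y hy hy'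
  rw [hy, hy']

/-- A measure whose conditional kernels are given by `K` is a product measure. -/
theorem IsProduct.succ [Nonempty E] {ρ : ProbabilityMeasure (Fin (n + 1) → E)}
    (hK : ∀ k < n, UniversallyMeasurable (K (t + k)))
    (h : IsProduct K ω n (ρ.map measurable_init.aemeasurable))
    (hρ : ∀ᵐ y ∂((ρ : Measure (Fin (n + 1) → E)).map fun y => Fin.init (α := fun _ => E) y),
      (K (t + n) (Fin.append ω y) : Measure E) =
        ((ρ : Measure (Fin (n + 1) → E)).map (splitLast n)).condKernel y) :
    IsProduct K ω (n + 1) ρ := by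
  have hi := h.hasIteratedIntegral hK
  rw [ProbabilityMeasure.toMeasure_map] at hi
  refine (hi.succ hρ ?_).isProduct
  rw [← fst_map_splitLast, Measure.disintegrate]

end Product

end RobustMarket

namespace RobustMarket

open Set Filter ProbabilityTheory

section Main

variable {E : Type*} [MeasurableSpace E]

/-! ### Marginals and conditional kernels -/

/-- The first `k` entries of a sequence of length `n`. -/
def takeFirst {E : Type*} {k n : ℕ} (h : k ≤ n) (y : Fin n → E) : Fin k → E :=
  fun j => y (Fin.castLE h j)

theorem measurable_takeFirst {k n : ℕ} (h : k ≤ n) : Measurable (takeFirst (E := E) h) :=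
  measurable_pi_iff.2 fun _ => measurable_pi_apply _

/-- The law of the first `k` entries. -/
noncomputable def marginal {k n : ℕ} (h : k ≤ n) (R : ProbabilityMeasure (Fin n → E)) :
    ProbabilityMeasure (Fin k → E) :=
  R.map (measurable_takeFirst h).aemeasurable

theorem coe_marginal {k n : ℕ} (h : k ≤ n) (R : ProbabilityMeasure (Fin n → E)) :
    (marginal h R : Measure (Fin k → E)) = (R : Measure (Fin n → E)).map (takeFirst h) :=
  ProbabilityMeasure.toMeasure_map _ _

theorem measurable_marginal {k n : ℕ} (h : k ≤ n) : Measurable (marginal (E := E) h) :=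
  ProbabilityMeasure.measurable_map (measurable_takeFirst h)

theorem marginal_self {n : ℕ} (R : ProbabilityMeasure (Fin n → E)) :
    marginal le_rfl R = R := by
  apply ProbabilityMeasure.toMeasure_injective
  rw [coe_marginal]
  exact Measure.map_id

theorem marginal_succ_map_init {k n : ℕ} (h : k < n) (R : ProbabilityMeasure (Fin n → E)) :
    (marginal h R).map measurable_init.aemeasurable = marginal h.le R := by
  apply ProbabilityMeasure.toMeasure_injective
  rw [ProbabilityMeasure.toMeasure_map, coe_marginal, coe_marginal,
    Measure.map_map measurable_init (measurable_takeFirst _)]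
  rfl

theorem IsProduct.marginal {K : ∀ i : ℕ, (Fin i → E) → ProbabilityMeasure E} {t : ℕ}
    {ω : Fin t → E} {n : ℕ} {R : ProbabilityMeasure (Fin n → E)} (hR : IsProduct K ω n R)
    {k : ℕ} (hk : k ≤ n) : IsProduct K ω k (marginal hk R) := by
  induction hk using Nat.decreasingInduction with
  | self => rwa [marginal_self]
  | of_succ k hk ih => rw [← marginal_succ_map_init hk]; exact ih.map_init

/-- The joint law of the first `k` entries and the next one, as a kernel. -/
noncomputable def splitKernel {k n : ℕ} (h : k < n) :
    Kernel (ProbabilityMeasure (Fin n → E)) ((Fin k → E) × E) :=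
  ProbabilityMeasure.toKernel (fun R => (marginal h R).map measurable_splitLast.aemeasurable)
    ((ProbabilityMeasure.measurable_map measurable_splitLast).comp (measurable_marginal h))

instance {k n : ℕ} (h : k < n) : IsMarkovKernel (splitKernel (E := E) h) :=
  inferInstanceAs (IsMarkovKernel (ProbabilityMeasure.toKernel _ _))

theorem splitKernel_apply {k n : ℕ} (h : k < n) (R : ProbabilityMeasure (Fin n → E)) :
    splitKernel h R = (marginal h R : Measure (Fin (k + 1) → E)).map (splitLast k) :=
  ProbabilityMeasure.toMeasure_map _ measurable_splitLast.aemeasurable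

theorem fst_splitKernel_apply {k n : ℕ} (h : k < n) (R : ProbabilityMeasure (Fin n → E)) :
    Kernel.fst (splitKernel h) R = (marginal h.le R : Measure (Fin k → E)) := by
  rw [Kernel.fst_apply, splitKernel_apply, ← marginal_succ_map_init h,
    ProbabilityMeasure.toMeasure_map]
  exact fst_map_splitLast _

variable [TopologicalSpace E] [PolishSpace E] [BorelSpace E]

/-- The conditional law of the entry with index `k` given the previous ones, jointly measurable in
the law of the sequence and the conditioning values. -/
noncomputable def condLaw [Nonempty E] {k n : ℕ} (h : k < n) :
    ProbabilityMeasure (Fin n → E) × (Fin k → E) → ProbabilityMeasure E :=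
  ProbabilityMeasure.ofKernel (splitKernel h).condKernel

theorem measurable_condLaw [Nonempty E] {k n : ℕ} (h : k < n) : Measurable (condLaw (E := E) h) :=
  ProbabilityMeasure.measurable_ofKernel _

/-- Links the version of the conditional law that is jointly measurable in `R` with the
disintegration of a single fixed `R`. -/
theorem condLaw_ae_eq [Nonempty E] {k n : ℕ} (h : k < n) (R : ProbabilityMeasure (Fin n → E)) :
    ∀ᵐ y ∂(marginal h.le R : Measure (Fin k → E)), (condLaw h (R, y) : Measure E) =
      ((marginal h R : Measure (Fin (k + 1) → E)).map (splitLast k)).condKernel y := by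
  have := Kernel.condKernel_apply_eq_condKernel (splitKernel (E := E) h) R
  rw [fst_splitKernel_apply] at this
  simpa only [splitKernel_apply] using! this

/-- A measure is a product measure if and only if its conditional laws are given by the kernels. -/
theorem isProduct_iff [Nonempty E] {K : ∀ i : ℕ, (Fin i → E) → ProbabilityMeasure E} {t : ℕ}
    {ω : Fin t → E} {n : ℕ} (hK : ∀ k < n, UniversallyMeasurable (K (t + k)))
    (R : ProbabilityMeasure (Fin n → E)) :
    IsProduct K ω n R ↔ ∀ (k : ℕ) (hk : k < n), ∀ᵐ y ∂(marginal hk.le R : Measure (Fin k → E)),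
      K (t + k) (Fin.append ω y) = condLaw hk (R, y) := by
  have hmap {k : ℕ} (hk : k < n) : (marginal hk R : Measure (Fin (k + 1) → E)).map
      (fun y => Fin.init (α := fun _ => E) y) = marginal hk.le R := by
    rw [← marginal_succ_map_init hk, ProbabilityMeasure.toMeasure_map]
  constructor
  · intro hR k hk
    have h := (hR.marginal (k := k + 1) hk).ae_eq_condKernel (fun j hj => hK j (by omega))
    rw [hmap hk] at h
    filter_upwards [h, condLaw_ae_eq hk R] with y h₁ h₂
    exact ProbabilityMeasure.toMeasure_injective (h₁.trans h₂.symm)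
  · intro h
    have hprod (k : ℕ) (hk : k ≤ n) : IsProduct K ω k (marginal hk R) := by
      induction k with
      | zero => exact isProduct_zero _
      | succ k ih =>
        refine IsProduct.succ (fun j hj => hK j (by omega)) ?_ ?_
        · rw [marginal_succ_map_init]
          exact ih _
        · rw [hmap hk]
          filter_upwards [h k hk, condLaw_ae_eq hk R] with y h₁ h₂
          rw [h₁, h₂]
    simpa [marginal_self] using hprod n le_rfl

/-! ### One-period martingale measures -/

/-- On triples `((ω, Q), P)` everything but `P ∈ Mod i ω` is a Borel condition, and that one is
analytic; projecting along `P` removes the existential. -/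
theorem analyticSet_graph_oneStepMartingaleMeasures
    {Mod : ∀ i : ℕ, (Fin i → E) → Set (ProbabilityMeasure E)} {S : ∀ i : ℕ, (Fin i → E) → ℝ}
    {i : ℕ} (hMod : AnalyticSet (graph (Mod i))) (hS : Measurable (S i))
    (hS' : Measurable (S (i + 1))) :
    AnalyticSet (graph (oneStepMartingaleMeasures Mod S i)) := by
  let Q : Kernel (((Fin i → E) × ProbabilityMeasure E) × ProbabilityMeasure E) E :=
    ProbabilityMeasure.toKernel (fun p => p.1.2)
    (measurable_snd.comp measurable_fst)
  let P : Kernel (((Fin i → E) × ProbabilityMeasure E) × ProbabilityMeasure E) E :=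
    ProbabilityMeasure.toKernel Prod.snd measurable_snd
  let f : ((Fin i → E) × ProbabilityMeasure E) × ProbabilityMeasure E → E → ℝ := fun p x =>
    S (i + 1) (Fin.snoc (α := fun _ => E) p.1.1 x) - S i p.1.1
  have hf : StronglyMeasurable (Function.uncurry f) := by
    have h₁ : Measurable fun q : (((Fin i → E) × ProbabilityMeasure E) × ProbabilityMeasure E) × E =>
        q.1.1.1 := by fun_prop
    have h₂ : Measurable fun q : (((Fin i → E) × ProbabilityMeasure E) × ProbabilityMeasure E) × E =>
        Fin.snoc (α := fun _ => E) q.1.1.1 q.2 :=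
      measurable_snoc.comp (h₁.prodMk measurable_snd)
    exact ((hS'.comp h₂).sub (hS.comp h₁)).stronglyMeasurable
  have hac : MeasurableSet {p | Q p ≪ P p} := Kernel.measurableSet_absolutelyContinuous Q P
  have hint : MeasurableSet {p | Integrable (f p) (Q p)} := measurableSet_kernel_integrable hf
  have hzero : MeasurableSet {p | ∫ x, f p x ∂(Q p) = 0} :=
    hf.integral_kernel_prod_right.measurable (measurableSet_singleton 0)
  have hg : AnalyticSet ((fun p : ((Fin i → E) × ProbabilityMeasure E) × ProbabilityMeasure E =>
      (p.1.1, p.2)) ⁻¹' graph (Mod i)) :=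
    hMod.preimage_of_measurable (by fun_prop)
  convert! (hg.inter (analyticSet_of_measurableSet
    (hac.inter (hint.inter hzero)))).image_of_continuous continuous_fst
  ext ⟨ω, Q'⟩
  constructor
  · rintro ⟨⟨P', hP', hQP⟩, h₁, h₂⟩
    exact ⟨((ω, Q'), P'), ⟨hP', hQP, h₁, h₂⟩, rfl⟩
  · rintro ⟨⟨⟨_, _⟩, P'⟩, ⟨hP', hQP, h₁, h₂⟩, h⟩
    obtain ⟨rfl, rfl⟩ := Prod.mk.inj h
    exact ⟨⟨P', hP', hQP⟩, h₁, h₂⟩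

/-! ### Martingale measures -/

/-- Turns kernels indexed by elapsed time into kernels indexed by absolute time, with arbitrary
values before `t`. -/
theorem exists_extend_add {β : ℕ → Type*} [∀ i, Nonempty (β i)] {t : ℕ} (q : ∀ k, β (t + k)) :
    ∃ Q : ∀ i, β i, ∀ k, Q (t + k) = q k := by
  have h (i : ℕ) : ∃ b : β i, ∀ (k : ℕ) (hk : t + k = i), hk ▸ q k = b := by
    by_cases hi : t ≤ i
    · obtain ⟨k, rfl⟩ := Nat.exists_eq_add_of_le hi
      refine ⟨q k, fun k' hk' => ?_⟩
      obtain rfl : k' = k := by omega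
      rfl
    · exact ⟨Classical.arbitrary _, fun k hk => absurd hk (by omega)⟩
  choose Q hQ using h
  exact ⟨Q, fun k => (hQ _ k rfl).symm⟩

/-- A universally measurable selector of an analytic correspondence can be modified so as to agree
with a given measurable selector wherever the latter takes its values in the correspondence. -/
theorem exists_isSelector_extend {α : Type*} [TopologicalSpace α] [PolishSpace α]
    [MeasurableSpace α] [BorelSpace α] [Nonempty E] {F : α → Set (ProbabilityMeasure E)}
    (hF : AnalyticSet (graph F)) {r : α → ProbabilityMeasure E} (hr : Measurable r) :
    ∃ q, IsSelector F q ∧ ∀ a, r a ∈ F a → q a = r a := by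
  classical
  have : Nonempty (ProbabilityMeasure E) := ⟨⟨Measure.dirac (Classical.arbitrary E), inferInstance⟩⟩
  obtain ⟨s, hs, hsF⟩ := hF.exists_universallyMeasurable_selection
  have hD : AnalyticSet {a | r a ∈ F a} :=
    hF.preimage_of_measurable (f := fun a => (a, r a)) (measurable_id.prodMk hr)
  refine ⟨fun a => if r a ∈ F a then r a else s a, ⟨?_, fun a ⟨P, hP⟩ => ?_⟩, fun a ha => ?_⟩
  -- The set where `r` is admissible is analytic, hence universally measurable, so gluing along it
  -- is allowed.
  · exact @Measurable.ite _ _ _ _ (universalCompletion α) _ _ _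
      hD.measurableSet_universalCompletion hr.universallyMeasurable hs
  · dsimp only
    split_ifs with ha
    exacts [ha, hsF a P hP]
  · exact if_pos ha

variable [Nonempty E] {Mod : ∀ i : ℕ, (Fin i → E) → Set (ProbabilityMeasure E)}
  {S : ∀ i : ℕ, (Fin i → E) → ℝ} {T t : ℕ}

/-- The dominated martingale measures are the measures whose conditional laws are one-period
martingale measures. -/
theorem mem_martingaleMeasures_iff
    (hF : ∀ k < T - t, AnalyticSet (graph (oneStepMartingaleMeasures Mod S (t + k))))
    {ω : Fin t → E} {R : ProbabilityMeasure (Fin (T - t) → E)} :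
    R ∈ martingaleMeasures Mod S T t ω ↔
      ∀ (k : ℕ) (hk : k < T - t), ∀ᵐ y ∂(R : Measure (Fin (T - t) → E)),
        condLaw hk (R, takeFirst hk.le y) ∈
          oneStepMartingaleMeasures Mod S (t + k) (Fin.append ω (takeFirst hk.le y)) := by
  constructor
  · rintro ⟨Q, hQ, hR, hne⟩ k hk
    have h := (isProduct_iff (fun j hj => (hQ (t + j) (by omega) (by omega)).1) R).1 hR k hk
    rw [coe_marginal] at h
    -- Nonemptiness along almost every path is what makes the selector property of `Q` apply.
    filter_upwards [hne k hk, ae_of_ae_map (measurable_takeFirst hk.le).aemeasurable h] with y h₁ h₂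
    rw [← h₂]
    exact (hQ (t + k) (by omega) (by omega)).2 _ h₁
  · intro h
    have hq (k : ℕ) : ∃ q : (Fin (t + k) → E) → ProbabilityMeasure E, ∀ hk : k < T - t,
        IsSelector (oneStepMartingaleMeasures Mod S (t + k)) q ∧
        ∀ᵐ y ∂(marginal hk.le R : Measure (Fin k → E)),
          q (Fin.append ω y) = condLaw hk (R, y) := by
      by_cases hk : k < T - t
      -- With `R` fixed, the kernel reads only the entries after time `t`, so it is a Borel function
      -- on all of `Fin (t + k) → E`.
      · have hr : Measurable fun η : Fin (t + k) → E =>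
            condLaw hk (R, fun j => η (Fin.natAdd t j)) :=
          (measurable_condLaw hk).comp (measurable_const.prodMk
            (measurable_pi_iff.2 fun j => measurable_pi_apply _))
        obtain ⟨q, hq, hqr⟩ := exists_isSelector_extend (hF k hk) hr
        refine ⟨q, fun _ => ⟨hq, ?_⟩⟩
        have hA : AnalyticSet {y : Fin k → E | condLaw hk (R, y) ∈
            oneStepMartingaleMeasures Mod S (t + k) (Fin.append ω y)} :=
          (hF k hk).preimage_of_measurable
            (f := fun y : Fin k → E => (Fin.append ω y, condLaw hk (R, y)))
            ((measurable_append.comp measurable_prodMk_left).prodMk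
              ((measurable_condLaw hk).comp measurable_prodMk_left))
        -- Transfers the almost sure condition from `R` to the law of its first `k` entries.
        have hae := ae_map_of_nullMeasurableSet (measurable_takeFirst hk.le).aemeasurable
          (hA.nullMeasurableSet _) (h k hk)
        rw [coe_marginal]
        filter_upwards [hae] with y hy
        have := hqr (Fin.append ω y)
        simp only [Fin.append_right] at this
        exact this hy
      · exact ⟨fun _ => ⟨Measure.dirac (Classical.arbitrary E), inferInstance⟩,
          fun hk' => absurd hk' hk⟩
    choose q hq using hq
    have (i : ℕ) : Nonempty ((Fin i → E) → ProbabilityMeasure E) :=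
      ⟨fun _ => ⟨Measure.dirac (Classical.arbitrary E), inferInstance⟩⟩
    obtain ⟨Q, hQ⟩ := exists_extend_add (β := fun i => (Fin i → E) → ProbabilityMeasure E) q
    have hsel (i : ℕ) (hi : t ≤ i) (hiT : i < T) :
        IsSelector (oneStepMartingaleMeasures Mod S i) (Q i) := by
      obtain ⟨k, rfl⟩ := Nat.exists_eq_add_of_le hi
      rw [hQ]
      exact (hq k (by omega)).1
    refine ⟨Q, hsel, ?_, fun k hk => ?_⟩
    · refine (isProduct_iff (fun k hk => (hsel (t + k) (by omega) (by omega)).1) R).2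
        fun k hk => ?_
      rw [hQ]
      exact (hq k hk).2
    · filter_upwards [h k hk] with y hy
      exact ⟨_, hy⟩

theorem analyticSet_graph_martingaleMeasures (ht : t < T)
    (hF : ∀ k < T - t, AnalyticSet (graph (oneStepMartingaleMeasures Mod S (t + k)))) :
    AnalyticSet (graph (martingaleMeasures Mod S T t)) := by
  -- The intersection over times must be nonempty for `AnalyticSet.iInter`; this is where `t < T`
  -- enters.
  have : Nonempty (Fin (T - t)) := ⟨⟨0, by omega⟩⟩
  let B : Fin (T - t) →
      Set (((Fin t → E) × ProbabilityMeasure (Fin (T - t) → E)) × (Fin (T - t) → E)) := fun k =>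
    (fun p => (Fin.append p.1.1 (takeFirst k.2.le p.2),
      condLaw k.2 (p.1.2, takeFirst k.2.le p.2))) ⁻¹'
        graph (oneStepMartingaleMeasures Mod S (t + k))
  have hB (k) : AnalyticSet (B k) := by
    have h : Measurable fun p : ((Fin t → E) × ProbabilityMeasure (Fin (T - t) → E)) ×
        (Fin (T - t) → E) => takeFirst k.2.le p.2 :=
      (measurable_takeFirst k.2.le).comp measurable_snd
    exact (hF k k.2).preimage_of_measurable
      ((measurable_append.comp ((measurable_fst.comp measurable_fst).prodMk h)).prodMk
        ((measurable_condLaw k.2).comp ((measurable_snd.comp measurable_fst).prodMk h)))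
  convert! AnalyticSet.iInter fun k =>
    (hB k).setOf_ae_mem (ProbabilityMeasure.toKernel Prod.snd measurable_snd)
  ext ⟨ω, R⟩
  simp only [mem_iInter]
  exact (mem_martingaleMeasures_iff hF).trans ⟨fun h k => h k k.2, fun h k hk => h ⟨k, hk⟩⟩

end Main

end RobustMarket

theorem proposition1p1 {E : Type*} [TopologicalSpace E] [PolishSpace E] [MeasurableSpace E]
    [BorelSpace E] (T : ℕ)
    (Mod : ∀ i : ℕ, (Fin i → E) → Set (ProbabilityMeasure E))
    (hMod_nonempty : ∀ i < T, ∀ ω, (Mod i ω).Nonempty)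
    (hMod_convex : ∀ i < T, ∀ ω,
      Convex ℝ≥0 ((fun P : ProbabilityMeasure E => (P : Measure E)) '' Mod i ω))
    (hMod_analytic : ∀ i < T, AnalyticSet (RobustMarket.graph (Mod i)))
    (S : ∀ i : ℕ, (Fin i → E) → ℝ) (hS : ∀ i ≤ T, Measurable (S i))
    (t : ℕ) (ht : t < T)
    (h_models : AnalyticSet (RobustMarket.graph (RobustMarket.models Mod T t))) :
    AnalyticSet (RobustMarket.graph (RobustMarket.martingaleMeasures Mod S T t)) := by
  -- A probability measure exists only on a nonempty space, and `Mod 0` supplies one because `0 <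
  -- T`.
  have : Nonempty E :=
    (hMod_nonempty 0 (Nat.zero_lt_of_lt ht) Fin.elim0).some.nonempty
  exact RobustMarket.analyticSet_graph_martingaleMeasures ht fun k hk =>
    RobustMarket.analyticSet_graph_oneStepMartingaleMeasures (hMod_analytic _ (by omega))
      (hS _ (by omega)) (hS _ (by omega))
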